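/- All graphs are finite and simple (no loops, no multiple edges). For a graph $G$, the neighborhood complex $\mathcal{N}(G)$ is the simplicial complex whose vertices are the non-isolated vertices of $G$ and whose simplices are the nonempty sets of vertices of $G$ that have a common neighbor. Let $T$ be the graph with vertices $1,\dots,8$ and edges $12, 13, 14, 27, 28, 47, 45, 35, 38, 56, 67, 68$ (this is the graph of the $3$-dimensional cube). \textbf{Theorem.} Let $G$ be a connected graph of maximal degree at most $3$ that is isomorphic neither to the complete graph $K_4$ nor to $T$. Then each connected component of (the geometric realization of) $\mathcal{N}(G)$ is either contractible or homotopy equivalent to a wedge sum of $n$ circles for some integer $n \geq 1$. -/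

import Mathlib

/-- The neighborhood complex of a graph: the nonempty finite sets of vertices that have a common
neighbor. (A vertex `v` is a vertex of the complex iff `{v}` is a face, i.e. iff `v` is not
isolated.) -/
def neighborhoodComplex {V : Type*} (G : SimpleGraph V) : PreAbstractSimplicialComplex V where
  faces := {s | s.Nonempty ∧ ∃ w : V, ∀ v ∈ s, G.Adj w v}
  isRelLowerSet_faces := by
    rintro s ⟨hs, w, hw⟩
    exact ⟨hs, fun t hts ht => ⟨ht, w, fun v hv => hw v (hts hv)⟩⟩

/-- The geometric realization of a simplicial complex on a finite vertex set: the points of the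
standard simplex whose support is contained in a face. It carries the subspace topology
of `V → ℝ`. -/
def geometricRealization {V : Type*} [Fintype V] (K : PreAbstractSimplicialComplex V) :
    Set (V → ℝ) :=
  {x | x ∈ stdSimplex ℝ V ∧ ∃ s ∈ K.faces, ∀ v, v ∉ s → x v = 0}

/-- The equivalence relation on a disjoint union that identifies all base points. -/
def wedgeSetoid {ι : Type*} (X : ι → Type*) (p : ∀ i, X i) : Setoid (Σ i, X i) where
  r a b := a = b ∨ (a.2 = p a.1 ∧ b.2 = p b.1)
  iseqv :=
    { refl := fun _ => Or.inl rfl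
      symm := by
        rintro a b (h | ⟨h₁, h₂⟩)
        · exact Or.inl h.symm
        · exact Or.inr ⟨h₂, h₁⟩
      trans := by
        rintro a b c (rfl | ⟨h₁, h₂⟩) (rfl | ⟨h₃, h₄⟩)
        · exact Or.inl rfl
        · exact Or.inr ⟨h₃, h₄⟩
        · exact Or.inr ⟨h₁, h₂⟩
        · exact Or.inr ⟨h₁, h₄⟩ }

/-- The wedge sum of a (nonempty) family of pointed spaces: the quotient of the disjoint union by
the identification of all base points. -/
def WedgeSum {ι : Type*} (X : ι → Type*) (p : ∀ i, X i) : Type _ :=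
  Quotient (wedgeSetoid X p)

/-- The wedge sum carries the quotient topology of the disjoint union topology. -/
instance {ι : Type*} (X : ι → Type*) (p : ∀ i, X i) [∀ i, TopologicalSpace (X i)] :
    TopologicalSpace (WedgeSum X p) :=
  inferInstanceAs (TopologicalSpace (Quotient (wedgeSetoid X p)))

/-- The wedge sum of `n` circles, for `n ≥ 1`. -/
abbrev WedgeOfCircles (n : ℕ) : Type :=
  WedgeSum (fun _ : Fin n => Circle) (fun _ => 1)

/-- The cubic graph `T` on eight vertices (isomorphic to the graph of the three-dimensional
cube). -/
def graphT : SimpleGraph (Fin 8) :=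
  SimpleGraph.fromEdgeSet
    {s(0, 1), s(0, 2), s(0, 3), s(1, 6), s(1, 7), s(3, 6), s(3, 4), s(2, 4), s(2, 7), s(4, 5),
      s(5, 6), s(5, 7)}

/-!
Two elementary facts reduce the theorem to the homotopy theory of finite graphs.

The faces of the neighborhood complex with three elements are neighborhoods `N(w)` of vertices of
degree three, and a vertex lies in at most three of them. If the triangles in some nonempty set
had no free edge, the link of each of their vertices would be a graph with at most three edges and
without leaves, that is, a triangle, so some of them would form the boundary of a tetrahedron
(`exists_tetrahedron_of_no_free_pair`). The four vertices and the four centers of that tetrahedron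
have no neighbors besides each other, so by connectedness they are the whole graph, which is then
`K₄` or the cube (`iso_of_tetrahedron`). In every other graph one triangle after another can
therefore be collapsed through a free edge. In barycentric coordinates an elementary collapse is an
explicit linear motion (`nonempty_homotopyEquiv_collapse`), and homotopy equivalences restrict to
components (`ContinuousMap.HomotopyEquiv.nonempty_connectedComponent`), so a complex of dimension at
most one remains (`exists_homotopyEquiv_card_le_two`).

In such a complex a subcomplex around a given vertex that is maximal among the contractible ones
spans a full component, since an edge leaving it could be added by a reverse collapse
(`exists_contractible_spanning`). The component is this contractible piece `A` with finitely many
arcs attached at their endpoints. Contracting `A` while dragging the endpoints of the arcs along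
yields a wedge of circles (`IsArcAttachment.homotopyEquiv_of_contractible`), or a contractible space
if there are no arcs (`isContractibleOrWedgeOfCircles_of_card_le_two`).

Realizations are taken of arbitrary families of finite sets, not necessarily closed under subsets,
so that a collapse only has to replace one member of the family.
-/

open unitInterval Topology

/-! ### Attaching arcs to a contractible space -/

/-- `Q` exhibits `X` as the space obtained from `A` by attaching a family of arcs indexed by `ι`,
the `i`-th arc running from `a i` to `b i`: it is a quotient map making no identifications other
than those of the endpoints of the arcs with points of `A`. -/
structure IsArcAttachment {A X ι : Type*} [TopologicalSpace A] [TopologicalSpace X]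
    [TopologicalSpace ι] (Q : A ⊕ ι × I → X) (a b : ι → A) : Prop where
  isQuotientMap : IsQuotientMap Q
  source : ∀ i, Q (Sum.inr (i, 0)) = Q (Sum.inl (a i))
  target : ∀ i, Q (Sum.inr (i, 1)) = Q (Sum.inl (b i))
  base_injective : ∀ x y, Q (Sum.inl x) = Q (Sum.inl y) → x = y
  arc_injective : ∀ i s, 0 < s → s < 1 → ∀ p, Q p = Q (Sum.inr (i, s)) → p = Sum.inr (i, s)

namespace IsArcAttachment

variable {A X ι Z : Type*} [TopologicalSpace A] [TopologicalSpace X] [TopologicalSpace ι]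
  [TopologicalSpace Z] {Q : A ⊕ ι × I → X} {a b : ι → A}

/-- Functions on `A` and on the arcs that agree at the endpoints factor through `Q`. -/
theorem eq_of_eq {S : Type*} (hQ : IsArcAttachment Q a b) {f : A ⊕ ι × I → S}
    (h0 : ∀ i, f (Sum.inr (i, 0)) = f (Sum.inl (a i)))
    (h1 : ∀ i, f (Sum.inr (i, 1)) = f (Sum.inl (b i))) {p q : A ⊕ ι × I} (hpq : Q p = Q q) :
    f p = f q := by
  have key : ∀ p : A ⊕ ι × I, (∃ i s, 0 < s ∧ s < 1 ∧ p = Sum.inr (i, s)) ∨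
      ∃ x, Q p = Q (Sum.inl x) ∧ f p = f (Sum.inl x) := by
    rintro (x | ⟨i, s⟩)
    · exact Or.inr ⟨x, rfl, rfl⟩
    · rcases eq_or_ne s 0 with rfl | hs0
      · exact Or.inr ⟨a i, hQ.source i, h0 i⟩
      · rcases eq_or_ne s 1 with rfl | hs1
        · exact Or.inr ⟨b i, hQ.target i, h1 i⟩
        · exact Or.inl ⟨i, s, unitInterval.pos_iff_ne_zero.2 hs0,
            unitInterval.lt_one_iff_ne_one.2 hs1, rfl⟩
  rcases key p with ⟨i, s, hs0, hs1, rfl⟩ | ⟨x, hx, hfx⟩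
  · rw [hQ.arc_injective i s hs0 hs1 q hpq.symm]
  · rcases key q with ⟨i, s, hs0, hs1, rfl⟩ | ⟨y, hy, hfy⟩
    · rw [hQ.arc_injective i s hs0 hs1 p hpq]
    · rw [hfx, hfy, hQ.base_injective x y (by rw [← hx, ← hy, hpq])]

theorem exists_lift (hQ : IsArcAttachment Q a b) {f : A ⊕ ι × I → Z} (hf : Continuous f)
    (h0 : ∀ i, f (Sum.inr (i, 0)) = f (Sum.inl (a i)))
    (h1 : ∀ i, f (Sum.inr (i, 1)) = f (Sum.inl (b i))) :
    ∃ g : C(X, Z), ∀ p, g (Q p) = f p := by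
  choose r hr using hQ.isQuotientMap.surjective
  have h : ∀ p, f (r (Q p)) = f p := fun p => hQ.eq_of_eq h0 h1 (hr (Q p))
  refine ⟨⟨fun x => f (r x), hQ.isQuotientMap.continuous_iff.2 ?_⟩, h⟩
  exact hf.congr fun p => (h p).symm

/-- A homotopy out of a space with attached arcs may be given on the base and the arcs
separately. -/
theorem exists_homotopy (hQ : IsArcAttachment Q a b) {f : I → A ⊕ ι × I → Z}
    (hfA : Continuous fun p : I × A => f p.1 (Sum.inl p.2))
    (hfι : Continuous fun p : I × (ι × I) => f p.1 (Sum.inr p.2))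
    (h0 : ∀ t i, f t (Sum.inr (i, 0)) = f t (Sum.inl (a i)))
    (h1 : ∀ t i, f t (Sum.inr (i, 1)) = f t (Sum.inl (b i))) (g₀ g₁ : C(X, Z))
    (hg₀ : ∀ p, g₀ (Q p) = f 0 p) (hg₁ : ∀ p, g₁ (Q p) = f 1 p) : g₀.Homotopic g₁ := by
  have hf : Continuous fun p : I × (A ⊕ ι × I) => f p.1 p.2 := by
    have h2 : Continuous ((fun p : I × (A ⊕ ι × I) => f p.1 p.2) ∘
        (Homeomorph.prodSumDistrib (X := I) (Y := A) (Z := ι × I)).symm) :=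
      continuous_sum_dom.2 ⟨hfA, hfι⟩
    exact (Homeomorph.comp_continuous_iff' _).1 h2
  choose r hr using hQ.isQuotientMap.surjective
  have h : ∀ t p, f t (r (Q p)) = f t p := fun t p => hQ.eq_of_eq (h0 t) (h1 t) (hr (Q p))
  have hc : Continuous fun p : I × X => f p.1 (r p.2) := by
    refine hQ.isQuotientMap.continuous_lift_prod_right ?_
    exact hf.congr fun p => (h p.1 p.2).symm
  refine ⟨⟨⟨_, hc⟩, fun x => ?_, fun x => ?_⟩⟩
  · obtain ⟨p, rfl⟩ := hQ.isQuotientMap.surjective x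
    simp only [h, hg₀]
  · obtain ⟨p, rfl⟩ := hQ.isQuotientMap.surjective x
    simp only [h, hg₁]

/-- Attaching arcs to a contractible space gives the same homotopy type as attaching them to a
point. The inverse of the map collapsing `A` sends each loop to the corresponding arc, preceded and
followed by the tracks of its endpoints under the contraction of `A`. -/
theorem homotopyEquiv_of_contractible [DiscreteTopology ι] [ContractibleSpace A] {W : Type*}
    [TopologicalSpace W]
    (hQ : IsArcAttachment Q a b) {Q' : Unit ⊕ ι × I → W}
    (hQ' : IsArcAttachment Q' (fun _ => ()) fun _ => ()) :
    Nonempty (ContinuousMap.HomotopyEquiv X W) := by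
  obtain ⟨x₀, ⟨H⟩⟩ := id_nullhomotopic A
  have hH0 : ∀ x, H (0, x) = x := fun x => H.map_zero_left x
  have hH1 : ∀ x, H (1, x) = x₀ := fun x => H.map_one_left x
  have hQc := hQ.isQuotientMap.continuous
  have hQc' := hQ'.isQuotientMap.continuous
  let pr : ℝ → I := Set.projIcc 0 1 zero_le_one
  have hpr : Continuous pr := continuous_projIcc
  have pr_le : ∀ u : ℝ, u ≤ 0 → pr u = 0 := fun u hu => Set.projIcc_of_le_left _ hu
  have pr_ge : ∀ u : ℝ, 1 ≤ u → pr u = 1 := fun u hu => Set.projIcc_of_right_le _ hu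
  have pr_coe : ∀ s : I, pr s = s := fun s => Set.projIcc_val _ s
  -- The `i`-th arc prolonged at both ends by the tracks of its endpoints under the contraction.
  let Ψ : ι × ℝ → X := fun p =>
    if p.2 ≤ 0 then Q (Sum.inl (H (pr (-p.2), a p.1)))
    else if p.2 ≤ 1 then Q (Sum.inr (p.1, pr p.2)) else Q (Sum.inl (H (pr (p.2 - 1), b p.1)))
  have hΨ : Continuous Ψ := by
    have ha : Continuous a := continuous_of_discreteTopology
    have hb : Continuous b := continuous_of_discreteTopology
    refine Continuous.if_le (by fun_prop) (Continuous.if_le (by fun_prop) (by fun_prop)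
      continuous_snd continuous_const ?_) continuous_snd continuous_const ?_
    · rintro ⟨i, u⟩ (rfl : u = 1)
      simp [pr_ge, pr_le, hH0, hQ.target]
    · rintro ⟨i, u⟩ (rfl : u = 0)
      simp [pr_le, hH0, hQ.source]
  have hΨ_le : ∀ i u, u ≤ 0 → Ψ (i, u) = Q (Sum.inl (H (pr (-u), a i))) := fun i u hu => if_pos hu
  have hΨ_mid : ∀ i (s : I), Ψ (i, s) = Q (Sum.inr (i, s)) := by
    intro i s
    rcases eq_or_ne s 0 with rfl | hs
    · rw [hΨ_le i _ (by simp), hQ.source, pr_le _ (by simp), hH0]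
    · have : 0 < (s : ℝ) := unitInterval.pos_iff_ne_zero.2 hs
      simp only [Ψ, pr_coe]
      rw [if_neg this.not_ge, if_pos s.2.2]
  have hΨ_ge : ∀ i u, 1 ≤ u → Ψ (i, u) = Q (Sum.inl (H (pr (u - 1), b i))) := by
    intro i u hu
    rcases hu.eq_or_lt with rfl | hu
    · rw [show (1 : ℝ) = ((1 : I) : ℝ) from rfl, hΨ_mid, hQ.target, pr_le _ (by simp), hH0]
    · simp only [Ψ]
      rw [if_neg (by linarith), if_neg (by linarith)]
  obtain ⟨F, hF⟩ := hQ.exists_lift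
    (f := Sum.elim (fun _ => Q' (Sum.inl ())) fun p => Q' (Sum.inr p))
    (continuous_sum_dom.2 ⟨continuous_const, hQc'.comp continuous_inr⟩)
    hQ'.source hQ'.target
  obtain ⟨G, hG⟩ := hQ'.exists_lift
    (f := Sum.elim (fun _ => Q (Sum.inl x₀)) fun p : ι × I => Ψ (p.1, 3 * p.2 - 1))
    (continuous_sum_dom.2 ⟨continuous_const, 
      hΨ.comp (f := fun p : ι × I => (p.1, (3 * p.2 - 1 : ℝ))) (by fun_prop)⟩)
    (fun i => by simp [hΨ_le, pr_ge, hH1])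
    (fun i => by
      simp only [Sum.elim_inr, Sum.elim_inl, Set.Icc.coe_one]
      rw [hΨ_ge i _ (by norm_num), pr_ge _ (by norm_num), hH1])
  have hFΨ : ∀ i u, F (Ψ (i, u)) = Q' (Sum.inr (i, pr u)) := by
    intro i u
    rcases le_total u 0 with h0 | h0
    · rw [hΨ_le i u h0, hF, pr_le u h0, hQ'.source]
      rfl
    · rcases le_total u 1 with h1 | h1
      · rw [show u = ((⟨u, h0, h1⟩ : I) : ℝ) from rfl, hΨ_mid, hF, pr_coe]
        rfl
      · rw [hΨ_ge i u h1, hF, pr_ge u h1, hQ'.target]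
        rfl
  -- Both composites are homotopic to the identity by letting the parameter of each arc run over
  -- `[-t, 1 + t]` at time `t`.
  have hstretch : Continuous fun p : I × (ι × I) =>
      (p.2.1, ((p.2.2 : ℝ) * (1 + 2 * p.1) - p.1)) := by fun_prop
  refine ⟨⟨F, G, ?_, ?_⟩⟩
  · refine (hQ.exists_homotopy (f := fun t => Sum.elim (fun x => Q (Sum.inl (H (t, x))))
      fun p : ι × I => Ψ (p.1, p.2 * (1 + 2 * t) - t)) ?_ ?_ ?_ ?_ _ _ ?_ ?_).symm
    · exact hQc.comp (continuous_inl.comp H.continuous)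
    · exact hΨ.comp hstretch
    · intro t i
      have ht := t.2.1
      simp only [Sum.elim_inl, Sum.elim_inr, Set.Icc.coe_zero]
      rw [hΨ_le i _ (by linarith)]
      simp [pr_coe]
    · intro t i
      have ht := t.2.1
      simp only [Sum.elim_inl, Sum.elim_inr, Set.Icc.coe_one]
      rw [hΨ_ge i _ (by linarith), show (1 * (1 + 2 * (t : ℝ)) - t - 1) = t by ring, pr_coe]
    · rintro (x | ⟨i, s⟩)
      · simp [hH0]
      · simp [hΨ_mid]
    · rintro (x | ⟨i, s⟩)
      · simp [hF, hG, hH1]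
      · simp only [ContinuousMap.comp_apply, hF, Sum.elim_inr, hG, Set.Icc.coe_one]
        congr 2
        ring
  · refine (hQ'.exists_homotopy (f := fun t => Sum.elim (fun _ => Q' (Sum.inl ()))
      fun p : ι × I => Q' (Sum.inr (p.1, pr (p.2 * (1 + 2 * t) - t)))) ?_ ?_ ?_ ?_ _ _ ?_ ?_).symm
    · exact continuous_const
    · simp only [Sum.elim_inr]
      fun_prop
    · intro t i
      have ht := t.2.1
      simp only [Sum.elim_inl, Sum.elim_inr, Set.Icc.coe_zero]
      rw [pr_le _ (by linarith), hQ'.source]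
    · intro t i
      have ht := t.2.1
      simp only [Sum.elim_inl, Sum.elim_inr, Set.Icc.coe_one]
      rw [pr_ge _ (by linarith), hQ'.target]
    · rintro (x | ⟨i, s⟩)
      · simp
      · simp [pr_coe]
    · rintro (x | ⟨i, s⟩)
      · simp [hF, hG]
      · simp only [ContinuousMap.comp_apply, hFΨ, Sum.elim_inr, hG, Set.Icc.coe_one]
        congr 4
        ring

end IsArcAttachment

/-- The wedge of `n ≥ 1` circles is obtained from a point by attaching `n` arcs. -/
theorem exists_isArcAttachment_wedgeOfCircles {n : ℕ} (hn : 1 ≤ n) :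
    ∃ Q : Unit ⊕ Fin n × I → WedgeOfCircles n,
      IsArcAttachment Q (fun _ => ()) fun _ => () := by
  let e : I → Circle := fun s => Circle.exp (2 * Real.pi * s)
  have he : Continuous e := by fun_prop
  have he0 : e 0 = 1 := by simp [e]
  have he1 : e 1 = 1 := by simp [e]
  have he_inj : ∀ s t : I, e s = e t → s < 1 → t < 1 → s = t := by
    intro s t h hs ht
    have hpi := Real.pi_pos
    have hmem : ∀ r : I, r < 1 → 2 * Real.pi * r ∈ Set.Ico 0 (2 * Real.pi) := fun r hr =>
      ⟨by have := r.2.1; positivity, by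
        have : (r : ℝ) < 1 := hr
        nlinarith⟩
    have := Circle.exp_injOn_Ico (a := 0) (b := 2 * Real.pi) (by simp) (hmem s hs) (hmem t ht) h
    exact Subtype.ext (mul_left_cancel₀ (by positivity) this)
  have he_surj : Function.Surjective e := by
    intro z
    obtain ⟨y, rfl⟩ := Circle.exp_surjective z
    refine ⟨⟨Int.fract (y / (2 * Real.pi)), Int.fract_nonneg _, (Int.fract_lt_one _).le⟩, ?_⟩
    refine Circle.exp_eq_exp.2 ⟨-⌊y / (2 * Real.pi)⌋, ?_⟩
    simp only [← Int.self_sub_floor]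
    have hpi := Real.pi_pos
    push_cast
    field_simp
    ring
  let ρ : Fin n × I → Σ _ : Fin n, Circle := fun p => ⟨p.1, e p.2⟩
  have hρ : Continuous ρ :=
    continuous_prod_of_discrete_left.2 fun i => continuous_sigmaMk.comp he
  have hρ_quot : IsQuotientMap ρ := by
    refine hρ.isClosedMap.isQuotientMap hρ ?_
    rintro ⟨i, z⟩
    obtain ⟨s, rfl⟩ := he_surj z
    exact ⟨(i, s), rfl⟩
  let mk : (Σ _ : Fin n, Circle) → WedgeOfCircles n :=
    Quotient.mk (wedgeSetoid (fun _ : Fin n => Circle) fun _ => 1)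
  have hmk : IsQuotientMap mk := isQuotientMap_quotient_mk'
  have hmk_eq : ∀ p q, mk p = mk q ↔ p = q ∨ (p.2 = 1 ∧ q.2 = 1) := fun p q => Quotient.eq
  let Q : Unit ⊕ Fin n × I → WedgeOfCircles n :=
    Sum.elim (fun _ => mk ⟨⟨0, hn⟩, 1⟩) fun p => mk (ρ p)
  have hQ : Continuous Q := continuous_sum_dom.2 ⟨continuous_const, hmk.continuous.comp hρ⟩
  refine ⟨Q, IsQuotientMap.of_comp continuous_inr hQ (hmk.comp hρ_quot), ?_, ?_, ?_, ?_⟩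
  · exact fun i => (hmk_eq _ _).2 (Or.inr ⟨he0, rfl⟩)
  · exact fun i => (hmk_eq _ _).2 (Or.inr ⟨he1, rfl⟩)
  · exact fun _ _ _ => rfl
  · intro i s hs0 hs1 p hp
    have hs : e s ≠ 1 := fun h => hs0.ne' (he_inj s 0 (h.trans he0.symm) hs1 zero_lt_one)
    rcases p with x | ⟨j, t⟩
    · rcases (hmk_eq _ _).1 hp with h | h
      · have h2 : (1 : Circle) = e s := by
          simpa using (Sigma.mk.inj_iff.1 h).2
        exact absurd h2.symm hs
      · exact absurd h.2 hs
    · rcases (hmk_eq _ _).1 hp with h | h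
      · obtain ⟨rfl, h2⟩ := Sigma.mk.inj_iff.1 h
        have h2 : e t = e s := by simpa using h2
        have ht : t < 1 := unitInterval.lt_one_iff_ne_one.2 fun ht => hs (by rw [← h2, ht, he1])
        rw [he_inj t s h2 ht hs1]
      · exact absurd h.2 hs

/-! ### Components under homotopy equivalence -/

/-- A space is contractible or homotopy equivalent to a wedge of at least one circle. -/
def IsContractibleOrWedgeOfCircles (X : Type*) [TopologicalSpace X] : Prop :=
  ContractibleSpace X ∨
    ∃ n : ℕ, 1 ≤ n ∧ Nonempty (ContinuousMap.HomotopyEquiv X (WedgeOfCircles n))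

theorem IsContractibleOrWedgeOfCircles.of_homotopyEquiv {X Y : Type*} [TopologicalSpace X]
    [TopologicalSpace Y] (h : IsContractibleOrWedgeOfCircles Y)
    (e : ContinuousMap.HomotopyEquiv X Y) : IsContractibleOrWedgeOfCircles X := by
  rcases h with h | ⟨n, hn, ⟨f⟩⟩
  · exact Or.inl e.contractibleSpace
  · exact Or.inr ⟨n, hn, ⟨e.trans f⟩⟩

theorem ContinuousMap.Homotopy.apply_mem_connectedComponent {X : Type*} [TopologicalSpace X]
    {f : C(X, X)} (H : f.Homotopy (ContinuousMap.id X)) (t : I) (x : X) :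
    H (t, x) ∈ connectedComponent x := by
  have hc : IsPreconnected (Set.range fun s : I => H (s, x)) :=
    isPreconnected_range (H.continuous.comp (Continuous.prodMk_left x))
  exact hc.subset_connectedComponent ⟨1, H.map_one_left x⟩ ⟨t, rfl⟩

/-- A homotopy equivalence restricts to homotopy equivalences between components: the homotopies
move each point within its component. -/
theorem ContinuousMap.HomotopyEquiv.nonempty_connectedComponent {X Y : Type*} [TopologicalSpace X]
    [TopologicalSpace Y] (e : ContinuousMap.HomotopyEquiv X Y) (x : X) :
    Nonempty (ContinuousMap.HomotopyEquiv (connectedComponent x)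
      (connectedComponent (e x))) := by
  obtain ⟨H⟩ := e.left_inv
  obtain ⟨K⟩ := e.right_inv
  have hf : ∀ y ∈ connectedComponent x, e y ∈ connectedComponent (e x) :=
    e.continuous.mapsTo_connectedComponent x
  have hx : e.symm (e x) ∈ connectedComponent x := by
    have := H.apply_mem_connectedComponent 0 x
    rwa [H.apply_zero] at this
  have hg : ∀ y ∈ connectedComponent (e x), e.symm y ∈ connectedComponent x := by
    rw [connectedComponent_eq hx]
    exact e.symm.continuous.mapsTo_connectedComponent (e x)
  have hH : ∀ (t : I) (y : connectedComponent x), H (t, y) ∈ connectedComponent x := by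
    rintro t ⟨y, hy⟩
    exact (connectedComponent_eq hy).symm.subset (H.apply_mem_connectedComponent t y)
  have hK : ∀ (t : I) (y : connectedComponent (e x)),
      K (t, y) ∈ connectedComponent (e x) := by
    rintro t ⟨y, hy⟩
    exact (connectedComponent_eq hy).symm.subset (K.apply_mem_connectedComponent t y)
  refine ⟨⟨⟨fun y => ⟨e y, hf y y.2⟩, ?_⟩, ⟨fun y => ⟨e.symm y, hg y y.2⟩, ?_⟩,
    ⟨⟨⟨fun p => ⟨H (p.1, p.2), hH p.1 p.2⟩, ?_⟩, ?_, ?_⟩⟩,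
    ⟨⟨⟨fun p => ⟨K (p.1, p.2), hK p.1 p.2⟩, ?_⟩, ?_, ?_⟩⟩⟩⟩
  · exact (e.continuous.comp continuous_subtype_val).subtype_mk _
  · exact (e.symm.continuous.comp continuous_subtype_val).subtype_mk _
  · exact (H.continuous.comp (by fun_prop)).subtype_mk _
  · exact fun y => Subtype.ext (H.apply_zero _)
  · exact fun y => Subtype.ext (H.apply_one _)
  · exact (K.continuous.comp (by fun_prop)).subtype_mk _
  · exact fun y => Subtype.ext (K.apply_zero _)
  · exact fun y => Subtype.ext (K.apply_one _)

theorem connectedComponent_eq_of_isClopen {X : Type*} [TopologicalSpace X] {U : Set X}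
    (hU : IsClopen U) (hc : IsPreconnected U) {x : X} (hx : x ∈ U) : connectedComponent x = U :=
  (hU.connectedComponent_subset hx).antisymm (hc.subset_connectedComponent hx)

theorem IsArcAttachment.preconnectedSpace {A X ι : Type*} [TopologicalSpace A]
    [TopologicalSpace X] [TopologicalSpace ι] [ConnectedSpace A] {Q : A ⊕ ι × I → X} {a b : ι → A}
    (hQ : IsArcAttachment Q a b) : PreconnectedSpace X := by
  have hQc := hQ.isQuotientMap.continuous
  obtain ⟨x₀⟩ := (inferInstance : Nonempty A)
  have hA : ∀ y, Q (Sum.inl y) ∈ connectedComponent (Q (Sum.inl x₀)) := fun y =>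
    (isPreconnected_range (hQc.comp continuous_inl)).subset_connectedComponent ⟨x₀, rfl⟩ ⟨y, rfl⟩
  refine preconnectedSpace_iff_connectedComponent.2 fun x => ?_
  suffices h : ∀ y, y ∈ connectedComponent (Q (Sum.inl x₀)) by
    rw [← connectedComponent_eq (h x)]
    exact Set.eq_univ_of_forall h
  intro y
  obtain ⟨y | ⟨i, s⟩, rfl⟩ := hQ.isQuotientMap.surjective y
  · exact hA y
  · rw [connectedComponent_eq (hA (a i))]
    have hc : Continuous fun s : I => Q (Sum.inr (i, s)) := by fun_prop
    exact (isPreconnected_range hc).subset_connectedComponent ⟨0, hQ.source i⟩ ⟨s, rfl⟩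

/-! ### Realizations of families of simplices and elementary collapses -/

section Collapse

variable {V : Type*}

/-- The union of the simplices of the standard simplex on `V` spanned by the members of `F`. The
family need not be closed under passing to subsets, so it may be taken to be a set of facets. -/
def familyRealization [Fintype V] (F : Set (Finset V)) : Set (V → ℝ) :=
  {x | x ∈ stdSimplex ℝ V ∧ ∃ s ∈ F, ∀ v, v ∉ s → x v = 0}

theorem familyRealization_mono [Fintype V] {F F' : Set (Finset V)} (h : ∀ s ∈ F, ∃ t ∈ F', s ⊆ t) :
    familyRealization F ⊆ familyRealization F' := by
  rintro x ⟨hx, s, hs, hsx⟩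
  obtain ⟨t, ht, hst⟩ := h s hs
  exact ⟨hx, t, ht, fun v hv => hsx v fun hvs => hv (hst hvs)⟩

theorem familyRealization_congr [Fintype V] {F F' : Set (Finset V)} (h : ∀ s ∈ F, ∃ t ∈ F', s ⊆ t)
    (h' : ∀ s ∈ F', ∃ t ∈ F, s ⊆ t) : familyRealization F = familyRealization F' :=
  (familyRealization_mono h).antisymm (familyRealization_mono h')

variable [DecidableEq V]

/-- The linear motion that pushes a point away from the face `ρ` towards the vertex `c`; it is at
rest at the points where some coordinate in `ρ` vanishes. -/
def collapseMap (ρ : Finset V) (hρ : ρ.Nonempty) (c : V) (t : ℝ) (x : V → ℝ) (v : V) : ℝ :=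
  x v + t * ρ.inf' hρ x * (if v = c then (ρ.card : ℝ) else if v ∈ ρ then -1 else 0)

variable {ρ : Finset V} {hρ : ρ.Nonempty} {c : V}

theorem continuous_collapseMap :
    Continuous fun p : ℝ × (V → ℝ) => collapseMap ρ hρ c p.1 p.2 := by
  have hm : Continuous fun p : ℝ × (V → ℝ) => ρ.inf' hρ p.2 :=
    Continuous.finset_inf'_apply hρ fun v _ => by fun_prop
  unfold collapseMap
  fun_prop

theorem collapseMap_eq_self {t : ℝ} {x : V → ℝ} (h0 : ∀ v, 0 ≤ x v) {v : V} (hv : v ∈ ρ)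
    (hxv : x v = 0) : collapseMap ρ hρ c t x = x := by
  have : ρ.inf' hρ x = 0 :=
    le_antisymm ((Finset.inf'_le _ hv).trans hxv.le) (Finset.le_inf' _ _ fun w _ => h0 w)
  funext w
  simp [collapseMap, this]

theorem collapseMap_mem_stdSimplex [Fintype V] (hc : c ∉ ρ) {t : ℝ} (ht : t ∈ Set.Icc (0 : ℝ) 1)
    {x : V → ℝ} (hx : x ∈ stdSimplex ℝ V) : collapseMap ρ hρ c t x ∈ stdSimplex ℝ V := by
  have hm : 0 ≤ ρ.inf' hρ x := Finset.le_inf' _ _ fun w _ => hx.1 w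
  refine ⟨fun v => ?_, ?_⟩
  · have hv := hx.1 v
    have ht0 := ht.1
    unfold collapseMap
    split_ifs with h h
    · positivity
    · have h1 : ρ.inf' hρ x ≤ x v := Finset.inf'_le _ h
      nlinarith [ht.2]
    · simpa using hv
  · have : ∑ v, (if v = c then (ρ.card : ℝ) else if v ∈ ρ then -1 else 0) = 0 := by
      have h : ∀ v, (if v = c then (ρ.card : ℝ) else if v ∈ ρ then -1 else 0) =
          (if v = c then (ρ.card : ℝ) else 0) + if v ∈ ρ then -1 else 0 := by
        intro v
        split_ifs with h1 h2 <;> simp_all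
      simp [h, Finset.sum_add_distrib]
    simp only [collapseMap, Finset.sum_add_distrib, ← Finset.mul_sum, this, hx.2]
    simp

/-- Elementary collapse: if every member of `F` containing `ρ` lies in the member
`insert c ρ`, then this member may be replaced by its faces `insert c (ρ.erase v)`. -/
theorem nonempty_homotopyEquiv_collapse [Fintype V] (hρ : ρ.Nonempty) (hc : c ∉ ρ)
    {F : Set (Finset V)} (hτ : insert c ρ ∈ F) (hfree : ∀ s ∈ F, ρ ⊆ s → s ⊆ insert c ρ) :
    Nonempty (ContinuousMap.HomotopyEquiv (familyRealization F)
      (familyRealization ({s | s ∈ F ∧ ¬ ρ ⊆ s} ∪ {s | ∃ v ∈ ρ, s = insert c (ρ.erase v)}))) := by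
  set F' : Set (Finset V) := {s | s ∈ F ∧ ¬ ρ ⊆ s} ∪ {s | ∃ v ∈ ρ, s = insert c (ρ.erase v)}
  have hsub : familyRealization F' ⊆ familyRealization F := by
    refine familyRealization_mono ?_
    rintro s (hs | ⟨v, -, rfl⟩)
    · exact ⟨s, hs.1, subset_rfl⟩
    · exact ⟨_, hτ, Finset.insert_subset_insert _ (Finset.erase_subset _ _)⟩
  have hmem : ∀ t ∈ Set.Icc (0 : ℝ) 1, ∀ x ∈ familyRealization F,
      collapseMap ρ hρ c t x ∈ familyRealization F := by
    rintro t ht x ⟨hx, s, hs, hsx⟩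
    refine ⟨collapseMap_mem_stdSimplex hc ht hx, ?_⟩
    by_cases h : ρ ⊆ s
    · refine ⟨_, hτ, fun v hv => ?_⟩
      have h1 := hsx v fun h2 => hv (hfree s hs h h2)
      simp only [Finset.mem_insert, not_or] at hv
      simp [collapseMap, hv.1, hv.2, h1]
    · obtain ⟨v, hv, hvs⟩ := Finset.not_subset.1 h
      rw [collapseMap_eq_self hx.1 hv (hsx v hvs)]
      exact ⟨s, hs, hsx⟩
  have hmem' : ∀ x ∈ familyRealization F, collapseMap ρ hρ c 1 x ∈ familyRealization F' := by
    rintro x ⟨hx, s, hs, hsx⟩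
    refine ⟨collapseMap_mem_stdSimplex hc ⟨zero_le_one, le_rfl⟩ hx, ?_⟩
    by_cases h : ρ ⊆ s
    · -- A coordinate in `ρ` attaining the minimum becomes zero.
      obtain ⟨w, hw, hmin⟩ := Finset.exists_mem_eq_inf' hρ x
      refine ⟨_, Or.inr ⟨w, hw, rfl⟩, fun v hv => ?_⟩
      simp only [Finset.mem_insert, Finset.mem_erase, not_or, not_and] at hv
      by_cases hvw : v = w
      · subst hvw
        simp [collapseMap, hv.1, hw, hmin]
      · have hvρ := hv.2 hvw
        have h1 := hsx v fun h2 => by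
          simpa [hv.1, hvρ] using hfree s hs h h2
        simp [collapseMap, hv.1, hvρ, h1]
    · obtain ⟨v, hv, hvs⟩ := Finset.not_subset.1 h
      rw [collapseMap_eq_self hx.1 hv (hsx v hvs)]
      exact ⟨s, Or.inl ⟨hs, h⟩, hsx⟩
  have hfix : ∀ x ∈ familyRealization F', collapseMap ρ hρ c 1 x = x := by
    rintro x ⟨hx, s, ⟨-, h⟩ | ⟨v, hv, rfl⟩, hsx⟩
    · obtain ⟨v, hv, hvs⟩ := Finset.not_subset.1 h
      exact collapseMap_eq_self hx.1 hv (hsx v hvs)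
    · refine collapseMap_eq_self hx.1 hv (hsx v ?_)
      have : v ≠ c := fun h => hc (h ▸ hv)
      simpa using this
  refine ⟨⟨⟨fun x => ⟨_, hmem' x x.2⟩, ?_⟩, ⟨fun x => ⟨x, hsub x.2⟩, ?_⟩,
    ContinuousMap.Homotopic.symm
      ⟨⟨⟨fun p => ⟨collapseMap ρ hρ c p.1 p.2, hmem p.1 p.1.2 p.2 p.2.2⟩, ?_⟩, ?_, ?_⟩⟩, ?_⟩⟩
  · exact (continuous_collapseMap.comp
      (continuous_const.prodMk continuous_subtype_val)).subtype_mk _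
  · exact continuous_subtype_val.subtype_mk _
  · exact (continuous_collapseMap.comp (f := fun p : I × familyRealization F =>
      ((p.1 : ℝ), (p.2 : V → ℝ))) (by fun_prop)).subtype_mk _
  · intro x
    apply Subtype.ext
    funext v
    simp [collapseMap]
  · exact fun x => rfl
  · convert ContinuousMap.Homotopic.refl _
    ext x : 1
    exact (Subtype.ext (hfix x x.2)).symm

end Collapse

/-! ### Triples of neighbors without a free pair -/

/-- A nonempty family of three-element neighborhoods in a graph of maximal degree at most three, in
which no member has a pair of its own, contains the boundary of a tetrahedron: each vertex lies in
at most three members, so its link is forced to be a triangle. -/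
theorem exists_tetrahedron_of_no_free_pair {V : Type*} [Fintype V] [DecidableEq V]
    {G : SimpleGraph V} [DecidableRel G.Adj] (hdeg : ∀ v, G.degree v ≤ 3) {S : Set (Finset V)}
    (hS : S.Nonempty) (hcard : ∀ s ∈ S, s.card = 3) (hnbr : ∀ s ∈ S, ∃ w, G.neighborFinset w = s)
    (hfree : ∀ s ∈ S, ∀ ρ ⊆ s, ρ.card = 2 → ∃ t ∈ S, ρ ⊆ t ∧ t ≠ s) :
    ∃ v a b c : V, v ≠ a ∧ v ≠ b ∧ v ≠ c ∧ a ≠ b ∧ a ≠ c ∧ b ≠ c ∧ {a, b, c} ∈ S ∧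
      {v, b, c} ∈ S ∧ {v, a, c} ∈ S ∧ {v, a, b} ∈ S := by
  have other : ∀ x y z, x ≠ y → x ≠ z → y ≠ z → {x, y, z} ∈ S →
      ∃ u, u ≠ x ∧ u ≠ y ∧ u ≠ z ∧ {x, y, u} ∈ S := by
    intro x y z hxy hxz hyz hs
    obtain ⟨t, ht, hxyt, hne⟩ := hfree _ hs {x, y}
      (Finset.insert_subset_insert _ (by simp)) (Finset.card_pair hxy)
    obtain ⟨u, hu⟩ : ∃ u, t \ {x, y} = {u} := by
      rw [← Finset.card_eq_one, Finset.card_sdiff_of_subset hxyt, hcard t ht,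
        Finset.card_pair hxy]
    have htu : t = {x, y, u} := by
      rw [← Finset.sdiff_union_of_subset hxyt, hu, Finset.union_comm, Finset.insert_union,
        Finset.singleton_union]
    have hu' : u ∈ t \ {x, y} := by simp [hu]
    simp only [Finset.mem_sdiff, Finset.mem_insert, Finset.mem_singleton, not_or] at hu'
    refine ⟨u, hu'.2.1, hu'.2.2, ?_, htu ▸ ht⟩
    rintro rfl
    exact hne htu
  have atMostThree : ∀ v, ∀ s₁ ∈ S, ∀ s₂ ∈ S, ∀ s₃ ∈ S, ∀ s₄ ∈ S, v ∈ s₁ → v ∈ s₂ → v ∈ s₃ →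
      v ∈ s₄ → s₁ ≠ s₂ → s₁ ≠ s₃ → s₂ ≠ s₃ → s₄ = s₁ ∨ s₄ = s₂ ∨ s₄ = s₃ := by
    intro v s₁ h₁ s₂ h₂ s₃ h₃ s₄ h₄ hv₁ hv₂ hv₃ hv₄ h₁₂ h₁₃ h₂₃
    obtain ⟨w₁, rfl⟩ := hnbr _ h₁
    obtain ⟨w₂, rfl⟩ := hnbr _ h₂
    obtain ⟨w₃, rfl⟩ := hnbr _ h₃
    obtain ⟨w₄, rfl⟩ := hnbr _ h₄
    by_contra! hne
    obtain ⟨h₄₁, h₄₂, h₄₃⟩ := hne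
    have hsub : {w₄, w₁, w₂, w₃} ⊆ G.neighborFinset v := by
      simp only [SimpleGraph.mem_neighborFinset] at hv₁ hv₂ hv₃ hv₄
      simp [Finset.insert_subset_iff, hv₁.symm, hv₂.symm, hv₃.symm, hv₄.symm]
    have hle := (Finset.card_le_card hsub).trans (hdeg v)
    have hw : ∀ {x y}, G.neighborFinset x ≠ G.neighborFinset y → x ≠ y := fun h e => h (e ▸ rfl)
    rw [Finset.card_insert_of_notMem (by simp [hw h₄₁, hw h₄₂, hw h₄₃]),
      Finset.card_insert_of_notMem (by simp [hw h₁₂, hw h₁₃]), Finset.card_pair (hw h₂₃)] at hle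
    omega
  obtain ⟨τ, hτ⟩ := hS
  obtain ⟨v, a, b, hva, hvb, hab, rfl⟩ := Finset.card_eq_three.1 (hcard τ hτ)
  obtain ⟨c, hcv, hca, hcb, h₁⟩ := other v a b hva hvb hab hτ
  obtain ⟨d, hdv, hdb, hda, h₂⟩ := other v b a hvb hva hab.symm
    (by rwa [Finset.pair_comm b a])
  obtain ⟨e, hev, hec, hea, h₃⟩ := other v c a hcv.symm hva hca
    (by rwa [Finset.pair_comm c a])
  have hcd : c = d := by
    rcases atMostThree v _ hτ _ h₁ _ h₂ _ h₃ (by simp) (by simp) (by simp) (by simp)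
      (ne_of_mem_of_not_mem' (a := b) (by simp) (by simp [hvb.symm, hab.symm, hcb.symm]))
      (ne_of_mem_of_not_mem' (a := a) (by simp) (by simp [hva.symm, hab, hda.symm]))
      (ne_of_mem_of_not_mem' (a := a) (by simp) (by simp [hva.symm, hab, hda.symm])) with h | h | h
    · exact absurd (h.subset (by simp : c ∈ _)) (by simp [hcv, hca, hcb])
    · exact absurd (h.symm.subset (by simp : a ∈ _)) (by simp [hva.symm, hca.symm, hea.symm])
    · simpa [hcv, hcb] using h.subset (by simp : c ∈ _)
  subst hcd
  obtain ⟨g, hga, hgb, hgv, h₄⟩ := other a b v hab hva.symm hvb.symm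
    (by rwa [Finset.pair_comm b v, Finset.insert_comm])
  obtain ⟨k, hka, hkc, hkv, h₅⟩ := other a c v hca.symm hva.symm hcv
    (by rwa [Finset.pair_comm c v, Finset.insert_comm])
  have hcg : c = g := by
    rcases atMostThree a _ hτ _ h₁ _ h₄ _ h₅ (by simp) (by simp) (by simp) (by simp)
      (ne_of_mem_of_not_mem' (a := b) (by simp) (by simp [hvb.symm, hab.symm, hcb.symm]))
      (ne_of_mem_of_not_mem' (a := v) (by simp) (by simp [hva, hvb, hgv.symm]))
      (ne_of_mem_of_not_mem' (a := v) (by simp) (by simp [hva, hvb, hgv.symm])) with h | h | h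
    · exact absurd (h.subset (by simp : c ∈ _)) (by simp [hcv, hca, hcb])
    · exact absurd (h.symm.subset (by simp : v ∈ _)) (by simp [hva, hcv.symm, hkv.symm])
    · simpa [hca, hcb] using h.subset (by simp : c ∈ _)
  subst hcg
  exact ⟨v, a, b, c, hva, hvb, hcv.symm, hab, hca.symm, hcb.symm, h₄, h₂, h₁, hτ⟩

/-- If the boundary of a tetrahedron consists of neighborhoods in a connected graph of maximal
degree at most three, the four vertices and the four centers exhaust the graph, which is `K₄` or
the cube according to whether a vertex coincides with a center. -/
theorem iso_of_tetrahedron {V : Type*} [Fintype V] [DecidableEq V]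
    {G : SimpleGraph V} [DecidableRel G.Adj] (hconn : G.Connected) (hdeg : ∀ v, G.degree v ≤ 3)
    {f w : Fin 4 → V} (hf : Function.Injective f)
    (hw : ∀ i v, G.Adj (w i) v ↔ ∃ j, j ≠ i ∧ f j = v) :
    Nonempty (G ≃g SimpleGraph.completeGraph (Fin 4)) ∨ Nonempty (G ≃g graphT) := by
  have hwf : ∀ i j, G.Adj (w i) (f j) ↔ i ≠ j := by
    intro i j
    rw [hw]
    exact ⟨fun ⟨k, hk, h⟩ => hf h ▸ hk.symm, fun h => ⟨j, h.symm, rfl⟩⟩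
  have hwinj : Function.Injective w := by
    intro i j h
    by_contra hij
    exact ((hwf j j).1 (h ▸ (hwf i j).2 hij)) rfl
  have hfN : ∀ i v, G.Adj (f i) v ↔ ∃ j, j ≠ i ∧ w j = v := by
    intro i v
    have hsub : (Finset.univ.erase i).image w ⊆ G.neighborFinset (f i) := by
      intro v hv
      obtain ⟨j, hj, rfl⟩ := Finset.mem_image.1 hv
      simpa using ((hwf j i).2 (Finset.ne_of_mem_erase hj)).symm
    have heq := Finset.eq_of_subset_of_card_le hsub (by
      rw [Finset.card_image_of_injective _ hwinj]
      simpa using hdeg (f i))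
    rw [← SimpleGraph.mem_neighborFinset, ← heq]
    simp
  have hcover : ∀ v, v ∈ Set.range f ∪ Set.range w := by
    have step : ∀ u v, G.Walk u v → u ∈ Set.range f ∪ Set.range w →
        v ∈ Set.range f ∪ Set.range w := by
      intro u v p
      induction p with
      | nil => exact id
      | cons h _ ih =>
        intro hu
        refine ih ?_
        rcases hu with ⟨i, rfl⟩ | ⟨i, rfl⟩
        · obtain ⟨j, -, rfl⟩ := (hfN _ _).1 h
          exact Or.inr ⟨j, rfl⟩
        · obtain ⟨j, -, rfl⟩ := (hw _ _).1 h
          exact Or.inl ⟨j, rfl⟩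
    intro v
    obtain ⟨p⟩ := hconn.preconnected (f 0) v
    exact step _ _ p (Or.inl ⟨0, rfl⟩)
  have hdiag : ∀ i j, w i = f j → i = j := by
    intro i j h
    by_contra hij
    exact G.loopless.irrefl _ (h ▸ (hwf i j).2 hij)
  by_cases hmeet : ∃ i, w i = f i
  · left
    obtain ⟨i, hi⟩ := hmeet
    have hfw : ∀ j, f j = w j := by
      intro j
      rcases eq_or_ne j i with rfl | hj
      · exact hi.symm
      · obtain ⟨k, -, hk⟩ := (hfN i (f j)).1 (hi ▸ (hwf i j).2 hj.symm)
        rw [← hk, hdiag k j hk]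
    have hbij : Function.Bijective f := by
      refine ⟨hf, fun v => ?_⟩
      rcases hcover v with h | ⟨j, rfl⟩
      · exact h
      · exact ⟨j, hfw j⟩
    refine ⟨(⟨Equiv.ofBijective f hbij, ?_⟩ : SimpleGraph.completeGraph (Fin 4) ≃g G).symm⟩
    intro i j
    change G.Adj (f i) (f j) ↔ _
    rw [hfw i, hwf, SimpleGraph.top_adj]
  · right
    have hne : ∀ i j, w i ≠ f j := fun i j h => hmeet ⟨i, by rw [h, hdiag i j h]⟩
    -- The antipodal pairs of the cube `T` are `(0, 5)`, `(6, 2)`, `(7, 3)`, `(4, 1)`.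
    let e : Fin 8 → Fin 4 ⊕ Fin 4 :=
      ![.inl 0, .inr 3, .inr 1, .inr 2, .inl 3, .inr 0, .inl 1, .inl 2]
    have he : Function.Bijective e := by decide
    have hbij : Function.Bijective (Sum.elim f w) := by
      refine ⟨hf.sumElim hwinj fun i j h => hne j i h.symm, fun v => ?_⟩
      rcases hcover v with ⟨i, rfl⟩ | ⟨i, rfl⟩
      exacts [⟨.inl i, rfl⟩, ⟨.inr i, rfl⟩]
    have hadj : ∀ p q, G.Adj (Sum.elim f w p) (Sum.elim f w q) ↔
        p.isLeft ≠ q.isLeft ∧ p.elim id id ≠ q.elim id id := by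
      rintro (i | i) (j | j)
      · simpa using fun h => by
          obtain ⟨k, -, hk⟩ := (hfN _ _).1 h
          exact hne _ _ hk
      · have h := hwf j i
        rw [G.adj_comm, ne_comm] at h
        simpa using h
      · simp [hwf]
      · simpa using fun h => by
          obtain ⟨k, -, hk⟩ := (hw _ _).1 h
          exact hne _ _ hk.symm
    have hT : ∀ x y, graphT.Adj x y ↔
        (e x).isLeft ≠ (e y).isLeft ∧ (e x).elim id id ≠ (e y).elim id id := by
      simp only [graphT, SimpleGraph.fromEdgeSet_adj, Set.mem_insert_iff, Set.mem_singleton_iff]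
      decide
    refine ⟨(⟨(Equiv.ofBijective e he).trans (Equiv.ofBijective _ hbij), ?_⟩ : graphT ≃g G).symm⟩
    intro x y
    exact (hadj _ _).trans (hT x y).symm

/-! ### Reduction to dimension one -/

/-- If every nonempty set of triangles of a complex of dimension at most two has a member with an
edge in no other member, all triangles can be collapsed. -/
theorem exists_homotopyEquiv_card_le_two {V : Type*} [Fintype V] [DecidableEq V]
    {F : Set (Finset V)} (hF : ∀ s ∈ F, s.card ≤ 3)
    (hfree : ∀ S ⊆ {s | s ∈ F ∧ s.card = 3}, S.Nonempty →
      ∃ s ∈ S, ∃ ρ ⊆ s, ρ.card = 2 ∧ ∀ t ∈ S, ρ ⊆ t → t = s) :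
    ∃ F' : Set (Finset V), (∀ s ∈ F', s.card ≤ 2) ∧
      Nonempty (ContinuousMap.HomotopyEquiv (familyRealization F) (familyRealization F')) := by
  induction hn : {s | s ∈ F ∧ s.card = 3}.ncard using Nat.strong_induction_on generalizing F with
  | _ n ih =>
    rcases Set.eq_empty_or_nonempty {s | s ∈ F ∧ s.card = 3} with hS | hS
    · refine ⟨F, fun s hs => ?_, ⟨ContinuousMap.HomotopyEquiv.refl _⟩⟩
      have h1 := hF s hs
      have h2 : s.card ≠ 3 := fun h => (Set.eq_empty_iff_forall_notMem.1 hS s) ⟨hs, h⟩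
      omega
    · obtain ⟨s, hs, ρ, hρs, hρ, huniq⟩ := hfree _ subset_rfl hS
      obtain ⟨c, hc⟩ : ∃ c, s \ ρ = {c} := by
        rw [← Finset.card_eq_one, Finset.card_sdiff_of_subset hρs, hs.2, hρ]
      have hcρ : c ∉ ρ := (Finset.mem_sdiff.1 (hc.symm.subset (Finset.mem_singleton_self c))).2
      have hs_eq : s = insert c ρ := by
        rw [← Finset.sdiff_union_of_subset hρs, hc, Finset.singleton_union]
      have hcard : ∀ v ∈ ρ, (insert c (ρ.erase v)).card = 2 := by
        intro v hv
        rw [Finset.card_insert_of_notMem (fun h => hcρ (Finset.mem_of_mem_erase h)),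
          Finset.card_erase_of_mem hv, hρ]
      obtain ⟨e⟩ := nonempty_homotopyEquiv_collapse (F := F)
        (Finset.card_pos.1 (by omega)) hcρ (hs_eq ▸ hs.1) (by
          intro t ht hρt
          rw [← hs_eq]
          by_cases h3 : t.card = 3
          · rw [huniq t ⟨ht, h3⟩ hρt]
          · rw [← Finset.eq_of_subset_of_card_le hρt (by have := hF t ht; omega)]
            exact hρs)
      have hsub : {t | t ∈ {s | s ∈ F ∧ ¬ ρ ⊆ s} ∪ {s | ∃ v ∈ ρ, s = insert c (ρ.erase v)} ∧
          t.card = 3} ⊆ {s | s ∈ F ∧ s.card = 3} := by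
        rintro t ⟨ht | ⟨v, hv, rfl⟩, h3⟩
        · exact ⟨ht.1, h3⟩
        · have := hcard v hv
          omega
      obtain ⟨F', hF', ⟨e'⟩⟩ := ih _ (by
          rw [← hn]
          refine Set.ncard_lt_ncard ⟨hsub, fun h => ?_⟩
          obtain ⟨ht | ⟨v, hv, ht⟩, -⟩ := h hs
          · exact ht.2 hρs
          · have h2 := hcard v hv
            have h3 := hs.2
            rw [ht] at h3
            omega) (by
          rintro t (ht | ⟨v, hv, rfl⟩)
          · exact hF t ht.1
          · have := hcard v hv
            omega) (fun S hS => hfree S (hS.trans hsub)) rfl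
      exact ⟨F', hF', ⟨e.trans e'⟩⟩

/-! ### One-dimensional complexes -/

theorem isCompact_familyRealization {V : Type*} [Fintype V] (F : Set (Finset V)) :
    IsCompact (familyRealization F) := by
  have h : familyRealization F =
      stdSimplex ℝ V ∩ ⋃ s ∈ F, {x | ∀ v, v ∉ s → x v = 0} := by
    ext x
    simp [familyRealization]
  rw [h]
  refine (isCompact_stdSimplex ℝ V).inter_right (Set.Finite.isClosed_biUnion F.toFinite ?_)
  intro s _
  simp only [Set.ofPred_forall]
  exact isClosed_iInter fun v => isClosed_iInter fun _ =>
    isClosed_eq (continuous_apply v) continuous_const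

/-- In a complex of dimension at most one there is, around each vertex, a contractible subcomplex
`A` (a tree) whose vertex set `C` is closed under adjacency. It is obtained by maximality: an edge
leaving `C` could be added to `A`, as it collapses to its endpoint in `C`. -/
theorem exists_contractible_spanning {V : Type*} [Fintype V] [DecidableEq V]
    {F : Set (Finset V)} (hF : ∀ s ∈ F, s.card ≤ 2) {s₀ : Finset V} (hs₀ : s₀ ∈ F) {v₀ : V}
    (hv₀ : v₀ ∈ s₀) :
    ∃ (A : Set (Finset V)) (C : Finset V), v₀ ∈ C ∧ ContractibleSpace (familyRealization A) ∧
      (∀ a ∈ A, ∃ s ∈ F, a ⊆ s) ∧ (∀ v, v ∈ C ↔ ∃ a ∈ A, v ∈ a) ∧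
      ∀ s ∈ F, ∀ u ∈ s, u ∈ C → s ⊆ C := by
  classical
  let P : Finset V → Prop := fun C => ∃ A : Set (Finset V), v₀ ∈ C ∧
    ContractibleSpace (familyRealization A) ∧ (∀ a ∈ A, ∃ s ∈ F, a ⊆ s) ∧
    ∀ v, v ∈ C ↔ ∃ a ∈ A, v ∈ a
  have hP : P {v₀} := by
    refine ⟨{{v₀}}, by simp, ?_, ?_, by simp⟩
    · have hpt : ∀ x ∈ familyRealization {({v₀} : Finset V)}, x = Pi.single v₀ 1 := by
        rintro x ⟨hx, s, rfl, hsx⟩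
        have h0 : ∀ v, v ≠ v₀ → x v = 0 := fun v hv => hsx v (by simpa using hv)
        funext v
        by_cases hv : v = v₀
        · subst hv
          rw [Pi.single_eq_same, ← hx.2]
          exact (Finset.sum_eq_single v (fun w _ hw => h0 w hw) (by simp)).symm
        · simp [h0 v hv, hv]
      have : Subsingleton (familyRealization {({v₀} : Finset V)}) :=
        ⟨fun x y => Subtype.ext ((hpt x x.2).trans (hpt y y.2).symm)⟩
      have : Nonempty (familyRealization {({v₀} : Finset V)}) :=
        ⟨⟨Pi.single v₀ 1, single_mem_stdSimplex ℝ v₀, {v₀}, rfl, fun v hv =>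
          Pi.single_eq_of_ne (by simpa using hv) _⟩⟩
      infer_instance
    · rintro a rfl
      exact ⟨s₀, hs₀, by simpa using hv₀⟩
  obtain ⟨C, hC, hmax⟩ := Finset.exists_max_image (Finset.univ.filter P) Finset.card
    ⟨{v₀}, by simpa using hP⟩
  obtain ⟨A, hv₀C, hA, hAF, hCA⟩ := (Finset.mem_filter.1 hC).2
  refine ⟨A, C, hv₀C, hA, hAF, hCA, fun s hs u hu huC => ?_⟩
  by_contra hsC
  obtain ⟨b, hb, hbC⟩ := Finset.not_subset.1 hsC
  have hub : u ≠ b := fun h => hbC (h ▸ huC)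
  have hs_eq : {u, b} = s := Finset.eq_of_subset_of_card_le
    (by simp [Finset.insert_subset_iff, hu, hb]) (by rw [Finset.card_pair hub]; exact hF s hs)
  have hbA : ∀ a ∈ A, b ∉ a := fun a ha hba => hbC ((hCA b).2 ⟨a, ha, hba⟩)
  obtain ⟨e⟩ := nonempty_homotopyEquiv_collapse (ρ := {b}) (c := u) (F := insert {u, b} A)
    (by simp) (by simpa using hub) (Set.mem_insert _ _) (by
      rintro t (rfl | ht) hbt
      · rfl
      · exact absurd (Finset.singleton_subset_iff.1 hbt) (hbA t ht))
  rw [familyRealization_congr (F := _ ∪ _) (F' := A) ?_ ?_] at e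
  · have hlt := hmax (insert b C) (Finset.mem_filter.2 ⟨Finset.mem_univ _, insert {u, b} A,
      Finset.mem_insert_of_mem hv₀C, e.contractibleSpace, ?_, ?_⟩)
    · rw [Finset.card_insert_of_notMem hbC] at hlt
      omega
    · rintro a (rfl | ha)
      · exact ⟨s, hs, hs_eq.subset⟩
      · exact hAF a ha
    · intro v
      simp only [Finset.mem_insert, Set.mem_insert_iff, exists_eq_or_imp, Finset.mem_singleton,
        hCA]
      constructor
      · rintro (rfl | h)
        · exact Or.inl (Or.inr rfl)
        · exact Or.inr h
      · rintro ((rfl | rfl) | h)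
        · exact Or.inr ((hCA _).1 huC)
        · exact Or.inl rfl
        · exact Or.inr h
  · rintro t (⟨rfl | ht, hbt⟩ | ⟨v, hv, rfl⟩)
    · simp at hbt
    · exact ⟨t, ht, subset_rfl⟩
    · obtain ⟨a, ha, hua⟩ := (hCA u).1 huC
      obtain rfl := Finset.mem_singleton.1 hv
      exact ⟨a, ha, by simpa using hua⟩
  · exact fun a ha => ⟨a, Or.inl ⟨Or.inr ha, by simpa using hbA a ha⟩, subset_rfl⟩

/-- If `C` contains every member of the family that it meets, the points supported in `C` form an
open and closed subset: the complement consists of the points supported outside `C`. -/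
theorem isClopen_supported {V : Type*} [Fintype V] {F : Set (Finset V)} {C : Finset V}
    (hC : ∀ s ∈ F, ∀ u ∈ s, u ∈ C → s ⊆ C) :
    IsClopen {y : familyRealization F | ∀ v, v ∉ C → y.1 v = 0} := by
  have hclosed : ∀ p : V → Prop, IsClosed {y : familyRealization F | ∀ v, p v → y.1 v = 0} := by
    intro p
    simp only [Set.ofPred_forall]
    exact isClosed_iInter fun v => isClosed_iInter fun _ =>
      isClosed_eq ((continuous_apply v).comp continuous_subtype_val) continuous_const
  refine ⟨hclosed _, ?_⟩
  have hcompl : {y : familyRealization F | ∀ v, v ∉ C → y.1 v = 0}ᶜ =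
      {y : familyRealization F | ∀ v, v ∈ C → y.1 v = 0} := by
    ext ⟨y, hy, s, hs, hsy⟩
    simp only [Set.mem_compl_iff, Set.mem_ofPred_eq]
    constructor
    · intro h v hv
      refine hsy v fun hvs => h fun w hw => hsy w fun hws => hw (hC s hs v hvs hv hws)
    · intro h h'
      have : ∑ v, y v = 0 := Finset.sum_eq_zero fun v _ => by
        by_cases hv : v ∈ C
        exacts [h v hv, h' v hv]
      rw [hy.2] at this
      exact one_ne_zero this
  rw [← isClosed_compl_iff, hcompl]
  exact hclosed _

/-- The point of the edge from `p` to `q` with parameter `s`. -/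
def edgePoint {V : Type*} [DecidableEq V] (p q : V) (s : ℝ) (v : V) : ℝ :=
  if v = p then 1 - s else if v = q then s else 0

theorem continuous_edgePoint {V : Type*} [DecidableEq V] {p q : V} :
    Continuous (edgePoint p q) := by
  refine continuous_pi fun v => ?_
  unfold edgePoint
  split_ifs <;> fun_prop

theorem edgePoint_mem_stdSimplex {V : Type*} [Fintype V] [DecidableEq V] {p q : V} (h : p ≠ q)
    (s : I) : edgePoint p q s ∈ stdSimplex ℝ V := by
  refine ⟨fun v => ?_, ?_⟩
  · have h0 := s.2.1
    have h1 := s.2.2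
    unfold edgePoint
    split_ifs <;> linarith
  · have hv : ∀ v, edgePoint p q s v = (if v = p then 1 - (s : ℝ) else 0) +
        if v = q then (s : ℝ) else 0 := by
      intro v
      unfold edgePoint
      split_ifs with h1 h2 <;> simp_all
    simp [hv, Finset.sum_add_distrib]

/-- A point supported on two vertices lies on the edge between them. -/
theorem eq_edgePoint {V : Type*} [Fintype V] [DecidableEq V] {p q : V} (h : p ≠ q) {x : V → ℝ}
    (hx : x ∈ stdSimplex ℝ V) (h0 : ∀ v, v ∉ ({p, q} : Finset V) → x v = 0) :
    x q ∈ Set.Icc (0 : ℝ) 1 ∧ x = edgePoint p q (x q) := by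
  have hsum : x p + x q = 1 := by
    rw [← hx.2, ← Finset.sum_pair h]
    exact Finset.sum_subset (Finset.subset_univ _) fun v _ hv => h0 v hv
  refine ⟨⟨hx.1 q, by linarith [hx.1 p]⟩, ?_⟩
  funext v
  unfold edgePoint
  split_ifs with h1 h2
  · rw [h1]
    linarith
  · rw [h2]
  · exact h0 v (by simp [h1, h2])

/-- The components of a one-dimensional complex: the clopen set around a vertex is obtained from a
contractible spanning subcomplex by attaching the remaining edges. -/
theorem isContractibleOrWedgeOfCircles_of_card_le_two {V : Type*} [Fintype V]
    {F : Set (Finset V)} (hF : ∀ s ∈ F, s.card ≤ 2) (x : familyRealization F) :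
    IsContractibleOrWedgeOfCircles (connectedComponent x) := by
  classical
  obtain ⟨x, hx, s₀, hs₀, hsx⟩ := x
  have hne : ∀ y ∈ stdSimplex ℝ V, ∃ v, y v ≠ 0 := by
    intro y hy
    by_contra! h
    have := hy.2
    simp [h] at this
  obtain ⟨v₀, hv₀⟩ := hne x hx
  have hv₀s : v₀ ∈ s₀ := by
    by_contra h
    exact hv₀ (hsx v₀ h)
  obtain ⟨A, C, hv₀C, hA, hAF, hCA, hC⟩ := exists_contractible_spanning hF hs₀ hv₀s
  set U : Set (familyRealization F) := {y | ∀ v, v ∉ C → y.1 v = 0}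
  have hUclopen : IsClopen U := isClopen_supported hC
  have hxU : (⟨x, hx, s₀, hs₀, hsx⟩ : familyRealization F) ∈ U := fun v hv =>
    hsx v fun hvs => hv (hC s₀ hs₀ v₀ hv₀s hv₀C hvs)
  suffices h : IsContractibleOrWedgeOfCircles U ∧ PreconnectedSpace U by
    rw [connectedComponent_eq_of_isClopen hUclopen
      (isPreconnected_iff_preconnectedSpace.2 h.2) hxU]
    exact h.1
  have hAR : familyRealization A ⊆ familyRealization F := familyRealization_mono hAF
  have hAU : ∀ y (hy : y ∈ familyRealization A), (⟨y, hAR hy⟩ : familyRealization F) ∈ U := by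
    rintro y ⟨hy, a, ha, hay⟩ v hv
    exact hay v fun hva => hv ((hCA v).2 ⟨a, ha, hva⟩)
  let E := {e : Finset V // e ∈ F ∧ e ⊆ C ∧ e.card = 2 ∧ ∀ a ∈ A, ¬ e ⊆ a}
  let n := Fintype.card E
  let en : Fin n ≃ E := (Fintype.equivFin E).symm
  have hpq : ∀ i, ∃ p q, p ≠ q ∧ (en i).1 = {p, q} := fun i =>
    Finset.card_eq_two.1 (en i).2.2.2.1
  choose p q hpq hen using hpq
  have hpC : ∀ i, p i ∈ C := fun i => (en i).2.2.1 (by simp [hen])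
  have hqC : ∀ i, q i ∈ C := fun i => (en i).2.2.1 (by simp [hen])
  -- Every point of `U` lies in the contractible part or on one of the remaining edges.
  have hcover : ∀ y : U, y.1.1 ∈ familyRealization A ∨
      ∃ i, ∃ s : I, y.1.1 = edgePoint (p i) (q i) s := by
    rintro ⟨⟨y, hy, s, hs, hsy⟩, hyU⟩
    by_cases hsA : ∃ a ∈ A, s ⊆ a
    · obtain ⟨a, ha, hsa⟩ := hsA
      exact Or.inl ⟨hy, a, ha, fun v hv => hsy v fun hvs => hv (hsa hvs)⟩
    · push Not at hsA
      obtain ⟨v, hv⟩ := hne y hy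
      have hvC : v ∈ C := by
        by_contra h
        exact hv (hyU v h)
      have hvs : v ∈ s := by
        by_contra h
        exact hv (hsy v h)
      have hcard : s.card = 2 := by
        refine le_antisymm (hF s hs) ?_
        by_contra h
        obtain ⟨a, ha, hva⟩ := (hCA v).1 hvC
        refine hsA a ha fun w hw => ?_
        rwa [Finset.card_le_one.1 (by omega) w hw v hvs]
      obtain ⟨i, hi⟩ := en.surjective ⟨s, hs, hC s hs v hvs hvC, hcard, hsA⟩
      have hs_eq : s = {p i, q i} := by rw [← hen, hi]
      obtain ⟨hI, hyq⟩ := eq_edgePoint (hpq i) hy (hs_eq ▸ hsy)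
      exact Or.inr ⟨i, ⟨_, hI⟩, hyq⟩
  rcases Nat.eq_zero_or_pos n with hn | hn
  · have hall : ∀ y : U, y.1.1 ∈ familyRealization A := fun y =>
      (hcover y).resolve_right fun ⟨i, _⟩ => Fin.elim0 (hn ▸ i)
    let h : U ≃ₜ familyRealization A :=
      { toFun := fun y => ⟨y.1.1, hall y⟩
        invFun := fun y => ⟨⟨y.1, hAR y.2⟩, hAU y.1 y.2⟩
        left_inv := fun _ => rfl
        right_inv := fun _ => rfl
        continuous_toFun := by fun_prop
        continuous_invFun := by fun_prop }
    have hcontr : ContractibleSpace U := h.contractibleSpace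
    exact ⟨Or.inl hcontr, inferInstance⟩
  · have hvert : ∀ v ∈ C, Pi.single v (1 : ℝ) ∈ familyRealization A := by
      intro v hv
      obtain ⟨a, ha, hva⟩ := (hCA v).1 hv
      exact ⟨single_mem_stdSimplex ℝ v, a, ha, fun w hw =>
        Pi.single_eq_of_ne (by rintro rfl; exact hw hva) _⟩
    have hsupp : ∀ i s v, v ∉ (en i).1 → edgePoint (p i) (q i) s v = 0 := by
      intro i s v hv
      rw [hen, Finset.mem_insert, Finset.mem_singleton, not_or] at hv
      simp [edgePoint, hv.1, hv.2]
    have hedgeF : ∀ i (s : I), edgePoint (p i) (q i) s ∈ familyRealization F := fun i s =>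
      ⟨edgePoint_mem_stdSimplex (hpq i) s, (en i).1, (en i).2.1, hsupp i s⟩
    have hedgeU : ∀ i (s : I), (⟨_, hedgeF i s⟩ : familyRealization F) ∈ U := fun i s v hv =>
      hsupp i s v fun h => hv ((en i).2.2.1 h)
    let Q : familyRealization A ⊕ Fin n × I → U :=
      Sum.elim (fun y => ⟨⟨y.1, hAR y.2⟩, hAU y.1 y.2⟩)
        fun z => ⟨⟨_, hedgeF z.1 z.2⟩, hedgeU z.1 z.2⟩
    have hQc : Continuous Q := by
      refine continuous_sum_dom.2 ⟨?_, ?_⟩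
      · exact (continuous_subtype_val.subtype_mk _).subtype_mk _
      · refine Continuous.subtype_mk (Continuous.subtype_mk ?_ _) _
        refine continuous_prod_of_discrete_left.2 fun i => ?_
        exact (continuous_edgePoint (p := p i) (q := q i)).comp continuous_subtype_val
    have hQs : Function.Surjective Q := by
      intro y
      rcases hcover y with h | ⟨i, s, h⟩
      · exact ⟨Sum.inl ⟨_, h⟩, rfl⟩
      · exact ⟨Sum.inr (i, s), Subtype.ext (Subtype.ext h.symm)⟩
    have : CompactSpace (familyRealization A) :=
      isCompact_iff_compactSpace.1 (isCompact_familyRealization A)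
    have hQ : IsArcAttachment Q (fun i => ⟨_, hvert (p i) (hpC i)⟩)
        fun i => ⟨_, hvert (q i) (hqC i)⟩ := by
      refine ⟨hQc.isClosedMap.isQuotientMap hQc hQs, fun i => ?_, fun i => ?_,
        fun y z h => ?_, fun i s hs0 hs1 z hz => ?_⟩
      · refine Subtype.ext (Subtype.ext (funext fun v => ?_))
        simp [Q, edgePoint, Pi.single_apply]
      · refine Subtype.ext (Subtype.ext (funext fun v => ?_))
        by_cases hv : v = p i
        · subst hv
          simp [Q, edgePoint, hpq i]
        · simp [Q, edgePoint, Pi.single_apply, hv]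
      · exact Subtype.ext (congrArg (fun y : U => y.1.1) h)
      · have hs0' : (0 : ℝ) < s := hs0
        have hs1' : (s : ℝ) < 1 := hs1
        have hzv : ∀ v, (Q z).1.1 v = edgePoint (p i) (q i) s v := fun v =>
          congrArg (fun y : U => y.1.1 v) hz
        have hzp : (Q z).1.1 (p i) = 1 - s := by simp [hzv, edgePoint]
        have hzq : (Q z).1.1 (q i) = s := by simp [hzv, edgePoint, (hpq i).symm]
        -- A simplex containing the point contains the whole edge.
        have hmem : ∀ t : Finset V, (∀ v, v ∉ t → (Q z).1.1 v = 0) → (en i).1 ⊆ t := by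
          intro t ht
          rw [hen, Finset.insert_subset_iff, Finset.singleton_subset_iff]
          constructor <;> by_contra h
          · have := ht _ h
            linarith
          · have := ht _ h
            linarith
        rcases z with ⟨y, hy, a, ha, hay⟩ | ⟨j, t⟩
        · exact absurd (hmem a hay) ((en i).2.2.2.2 a ha)
        · have hij : (en i).1 = (en j).1 := Finset.eq_of_subset_of_card_le
            (hmem _ fun v hv => hsupp j t v hv) (by rw [(en i).2.2.2.1, (en j).2.2.2.1])
          obtain rfl := en.injective (Subtype.ext hij)
          have : (t : ℝ) = s := by
            rw [← hzq]
            simp [Q, edgePoint, (hpq i).symm]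
          rw [Subtype.ext this]
    obtain ⟨Q', hQ'⟩ := exists_isArcAttachment_wedgeOfCircles hn
    exact ⟨Or.inr ⟨n, hn, hQ.homotopyEquiv_of_contractible hQ'⟩, hQ.preconnectedSpace⟩

/-! ### Neighborhood complexes -/

/-- In a connected graph of maximal degree at most three other than `K₄` and the cube, every
nonempty family of three-element neighborhoods has a member with a pair of its own. -/
theorem exists_free_pair {V : Type*} [Fintype V] [DecidableEq V] {G : SimpleGraph V}
    [DecidableRel G.Adj] (hconn : G.Connected) (hdeg : ∀ v, G.degree v ≤ 3)
    (hK4 : ¬ Nonempty (G ≃g SimpleGraph.completeGraph (Fin 4)))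
    (hT : ¬ Nonempty (G ≃g graphT)) {S : Set (Finset V)} (hS : S.Nonempty)
    (hcard : ∀ s ∈ S, s.card = 3) (hnbr : ∀ s ∈ S, ∃ w, G.neighborFinset w = s) :
    ∃ s ∈ S, ∃ ρ ⊆ s, ρ.card = 2 ∧ ∀ t ∈ S, ρ ⊆ t → t = s := by
  by_contra! hfree
  obtain ⟨v, a, b, c, hva, hvb, hvc, hab, hac, hbc, h₀, h₁, h₂, h₃⟩ :=
    exists_tetrahedron_of_no_free_pair hdeg hS hcard hnbr hfree
  obtain ⟨w₀, h₀⟩ := hnbr _ h₀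
  obtain ⟨w₁, h₁⟩ := hnbr _ h₁
  obtain ⟨w₂, h₂⟩ := hnbr _ h₂
  obtain ⟨w₃, h₃⟩ := hnbr _ h₃
  have hf : Function.Injective ![v, a, b, c] := by
    intro i j h
    fin_cases i <;> fin_cases j <;> simp_all
  have hw : ∀ i u, G.Adj (![w₀, w₁, w₂, w₃] i) u ↔ ∃ j, j ≠ i ∧ ![v, a, b, c] j = u := by
    have hadj : ∀ {w s}, G.neighborFinset w = s → ∀ u, G.Adj w u ↔ u ∈ s := by
      rintro w _ rfl u
      exact (G.mem_neighborFinset w u).symm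
    intro i u
    fin_cases i <;>
      simp [hadj h₀, hadj h₁, hadj h₂, hadj h₃, Fin.exists_fin_succ, eq_comm]
  exact (iso_of_tetrahedron hconn hdeg hf hw).elim hK4 hT

theorem theorem3p1 {V : Type*} [Fintype V] (G : SimpleGraph V) [DecidableRel G.Adj]
    (hconn : G.Connected) (hdeg : G.maxDegree ≤ 3)
    (hK4 : ¬ Nonempty (G ≃g SimpleGraph.completeGraph (Fin 4)))
    (hT : ¬ Nonempty (G ≃g graphT))
    (x : geometricRealization (neighborhoodComplex G)) :
    ContractibleSpace (connectedComponent x) ∨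
      ∃ n : ℕ, 1 ≤ n ∧
        Nonempty (ContinuousMap.HomotopyEquiv (connectedComponent x) (WedgeOfCircles n)) := by
  classical
  have hdeg' : ∀ v, G.degree v ≤ 3 := fun v => (G.degree_le_maxDegree v).trans hdeg
  have hsub : ∀ s ∈ (neighborhoodComplex G).faces, ∃ w, s ⊆ G.neighborFinset w := by
    rintro s ⟨-, w, hw⟩
    exact ⟨w, fun v hv => (G.mem_neighborFinset w v).2 (hw v hv)⟩
  obtain ⟨F', hF', ⟨e⟩⟩ := exists_homotopyEquiv_card_le_two (F := (neighborhoodComplex G).faces)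
    (fun s hs => by
      obtain ⟨w, hw⟩ := hsub s hs
      exact (Finset.card_le_card hw).trans (hdeg' w))
    (fun S hS hSne => by
      refine exists_free_pair hconn hdeg' hK4 hT hSne (fun s hs => (hS hs).2) fun s hs => ?_
      obtain ⟨w, hw⟩ := hsub s (hS hs).1
      refine ⟨w, (Finset.eq_of_subset_of_card_le hw ?_).symm⟩
      rw [(hS hs).2]
      exact hdeg' w)
  obtain ⟨e'⟩ := e.nonempty_connectedComponent x
  exact (isContractibleOrWedgeOfCircles_of_card_le_two hF' (e x)).of_homotopyEquiv e'
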